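/- Let $\mathbf{MSL}$ be the category of meet-semilattices with a top element and maps preserving binary meets and top, and let $2=\{0,1\}$ be the two-element semilattice whose meet is the minimum. The dual adjunction $\mathbf{Set}(-,2)\dashv \mathbf{MSL}(-,2)\colon \mathbf{MSL}^{\mathrm{op}}\to\mathbf{Set}$ (where $\mathbf{Set}(X,2)$ carries the pointwise semilattice structure) induces the filter monad $\mathcal{F}$ on $\mathbf{Set}$, with $\mathcal{F}X=\mathbf{MSL}(\mathbf{Set}(X,2),2)$. Let $\mathcal{P}_{\mathrm f}$ be the finite power set monad on $\mathbf{Set}$. For a functor $F\colon \mathbf{A}\to\mathbf{C}$ whose right Kan extension $\mathrm{Ran}_F F$ along itself exists, with counit $\varphi\colon (\mathrm{Ran}_F F)F\to F$, the codensity monad of $F$ is the monad on $\mathbf{C}$ with underlying functor $\mathrm{Ran}_F F$, whose unit and multiplication correspond under the universal property of $\mathrm{Ran}_F F$ to $\mathrm{id}_F$ and to $\varphi\circ(\mathrm{Ran}_F F)\varphi$, respectively. Theorem. For each of the following two functors, the right Kan extension along itself exists and is pointwise (i.e. given by the limits $\lim_{X\to FA}FA$), and the filter monad $\mathcal{F}$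 is isomorphic, as a monad, to its codensity monad: 1. the forgetful functor $U\colon \mathbf{MSL}_{\mathrm f}\to\mathbf{Set}$ from the full subcategory $\mathbf{MSL}_{\mathrm f}\subseteq\mathbf{MSL}$ of finite meet-semilattices with top; 2. the forgetful functor $U_{\mathcal{P}_{\mathrm f}}\colon \mathbf{Kl}_{\mathrm f}(\mathcal{P}_{\mathrm f})\to\mathbf{Set}$ from the full subcategory of the Kleisli category of $\mathcal{P}_{\mathrm f}$ on the finite sets (equivalently, finite sets and relations), which sends $X$ to $\mathcal{P}_{\mathrm f}X$ and a Kleisli morphism $f\colon X\to\mathcal{P}_{\mathrm f}Y$ to $f^{\#}\colon \mathcal{P}_{\mathrm f}X\to\mathcal{P}_{\mathrm f}Y$, $S\mapsto\bigcup_{x\in S}f(x)$. -/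

import Mathlib

universe v v' w w' u

noncomputable section

namespace CodensityFilter

open CategoryTheory CategoryTheory.Functor

section Codensity

variable {A : Type w} [Category.{v} A] {C : Type w'} [Category.{v'} C]

/-- The unit of the codensity monad of `F`, corresponding under the universal property of
`Ran_F F` to `id : F ⟶ F`. -/
def codensityUnit (F : A ⥤ C) [F.HasRightKanExtension F] : 𝟭 C ⟶ F.rightKanExtension F :=
  (F.rightKanExtension F).liftOfIsRightKanExtension (F.rightKanExtensionCounit F) (𝟭 C)
    F.rightUnitor.hom

/-- The multiplication of the codensity monad of `F`, corresponding under the universal property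
of `Ran_F F` to `(Ran_F F) (Ran_F F) F ⟶ (Ran_F F) F ⟶ F`, that is `φ ∘ (Ran_F F) φ` with `φ` the
counit of `Ran_F F`. -/
def codensityMul (F : A ⥤ C) [F.HasRightKanExtension F] :
    F.rightKanExtension F ⋙ F.rightKanExtension F ⟶ F.rightKanExtension F :=
  (F.rightKanExtension F).liftOfIsRightKanExtension (F.rightKanExtensionCounit F)
    (F.rightKanExtension F ⋙ F.rightKanExtension F)
    ((Functor.associator F (F.rightKanExtension F) (F.rightKanExtension F)).inv ≫
      whiskerRight (F.rightKanExtensionCounit F) (F.rightKanExtension F) ≫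
      F.rightKanExtensionCounit F)

theorem codensityUnit_fac (F : A ⥤ C) [F.HasRightKanExtension F] (X : A) :
    (codensityUnit F).app (F.obj X) ≫ (F.rightKanExtensionCounit F).app X = 𝟙 (F.obj X) :=
  (F.rightKanExtension F).liftOfIsRightKanExtension_fac_app (F.rightKanExtensionCounit F) _ _ X

theorem codensityMul_fac (F : A ⥤ C) [F.HasRightKanExtension F] (X : A) :
    (codensityMul F).app (F.obj X) ≫ (F.rightKanExtensionCounit F).app X =
      (F.rightKanExtension F).map ((F.rightKanExtensionCounit F).app X) ≫
        (F.rightKanExtensionCounit F).app X :=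
  ((F.rightKanExtension F).liftOfIsRightKanExtension_fac_app
    (F.rightKanExtensionCounit F) _ _ X).trans (Category.id_comp _)

/-- The codensity monad of `F : A ⥤ C`, for `F` admitting a right Kan extension `Ran_F F` along
itself. -/
def codensityMonad (F : A ⥤ C) [F.HasRightKanExtension F] : Monad C where
  toFunctor := F.rightKanExtension F
  η := codensityUnit F
  μ := codensityMul F
  assoc X := by
    have h : whiskerRight (codensityMul F) (F.rightKanExtension F) ≫ codensityMul F =
        (Functor.associator _ _ _).hom ≫ whiskerLeft (F.rightKanExtension F) (codensityMul F) ≫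
          codensityMul F := by
      apply (F.rightKanExtension F).hom_ext_of_isRightKanExtension (F.rightKanExtensionCounit F)
      ext Y
      have e := (codensityMul F).naturality ((F.rightKanExtensionCounit F).app Y)
      dsimp at e ⊢
      simp only [Category.assoc, Category.id_comp, codensityMul_fac, ← Functor.map_comp_assoc]
      rw [Functor.map_comp_assoc, ← reassoc_of% e, codensityMul_fac]
    simpa using NatTrans.congr_app h X
  left_unit X := by
    have h : whiskerLeft (F.rightKanExtension F) (codensityUnit F) ≫ codensityMul F =
        (Functor.rightUnitor _).hom := by
      apply (F.rightKanExtension F).hom_ext_of_isRightKanExtension (F.rightKanExtensionCounit F)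
      ext Y
      have e := (codensityUnit F).naturality ((F.rightKanExtensionCounit F).app Y)
      dsimp at e ⊢
      simp only [Category.assoc, Category.id_comp, codensityMul_fac]
      rw [← reassoc_of% e, codensityUnit_fac, Category.comp_id]
    simpa using NatTrans.congr_app h X
  right_unit X := by
    have h : whiskerRight (codensityUnit F) (F.rightKanExtension F) ≫ codensityMul F =
        (Functor.leftUnitor _).hom := by
      apply (F.rightKanExtension F).hom_ext_of_isRightKanExtension (F.rightKanExtensionCounit F)
      ext Y
      dsimp
      simp only [Category.assoc, Category.id_comp, codensityMul_fac, ← Functor.map_comp_assoc,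
        codensityUnit_fac]
      exact (congrArg (· ≫ _) ((F.rightKanExtension F).map_id _)).trans (Category.id_comp _)
    simpa using NatTrans.congr_app h X

/-- `T` is the (pointwise) codensity monad of `F`: the right Kan extension of `F` along itself
exists and is given by the pointwise limit formula, and the codensity monad of `F` is isomorphic
to `T` in the category of monads and monad morphisms. -/
def IsCodensityMonadOf (T : Monad C) (F : A ⥤ C) : Prop :=
  ∃ _ : F.HasPointwiseRightKanExtension F, Nonempty (T ≅ codensityMonad F)

end Codensity

section FilterMonad

/-- The contravariant functor `Set(-, 2)` from sets to meet-semilattices with top; the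
semilattice structure on `X → 2` is pointwise, and `2 = Bool` has minimum as its meet. -/
def powerFunctor : Type u ⥤ SemilatInfCat.{u}ᵒᵖ where
  obj X := .op (.of (X → Bool))
  map {X Y} f := Quiver.Hom.op (X := SemilatInfCat.of (Y → Bool)) (Y := SemilatInfCat.of (X → Bool))
    (show InfTopHom (Y → Bool) (X → Bool) from
      { toFun := fun p x => p (f x)
        map_inf' := fun _ _ => rfl
        map_top' := rfl })
  map_id _ := rfl
  map_comp _ _ := rfl

/-- The contravariant functor `MSL(-, 2)` from meet-semilattices with top to sets. -/
def homToTwoFunctor : SemilatInfCat.{u}ᵒᵖ ⥤ Type u where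
  obj M := InfTopHom M.unop Bool
  map {M N} f := TypeCat.ofHom fun (χ : InfTopHom M.unop Bool) =>
    χ.comp (show InfTopHom N.unop M.unop from f.unop)
  map_id _ := rfl
  map_comp _ _ := rfl

/-- The dual adjunction `Set(-, 2) ⊣ MSL(-, 2)`, which exchanges the arguments of a function of
two variables. -/
def filterAdjunction : powerFunctor.{u} ⊣ homToTwoFunctor.{u} :=
  Adjunction.mkOfHomEquiv
    { homEquiv X M :=
        { toFun g := TypeCat.ofHom fun x =>
            show InfTopHom M.unop Bool from
              { toFun := fun m => (show InfTopHom M.unop (X → Bool) from g.unop) m x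
                map_inf' := fun a b =>
                  congrFun (map_inf (show InfTopHom M.unop (X → Bool) from g.unop) a b) x
                map_top' := congrFun (map_top (show InfTopHom M.unop (X → Bool) from g.unop)) x }
          invFun h := Quiver.Hom.op (X := M.unop) (Y := SemilatInfCat.of (X → Bool))
            (show InfTopHom M.unop (X → Bool) from
              { toFun := fun m x => (show InfTopHom M.unop Bool from h x) m
                map_inf' := fun a b => funext fun x =>
                  map_inf (show InfTopHom M.unop Bool from h x) a b
                map_top' := funext fun x => map_top (show InfTopHom M.unop Bool from h x) })
          left_inv _ := rfl
          right_inv _ := rfl }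
      homEquiv_naturality_left_symm := fun _ _ => rfl
      homEquiv_naturality_right := fun _ _ => rfl }

/-- The filter monad `X ↦ MSL(Set(X, 2), 2)` on `Set`, induced by the dual adjunction. -/
def filterMonad : Monad (Type u) := filterAdjunction.toMonad

end FilterMonad

section Functors

/-- The category `MSL_f` of finite meet-semilattices with top. -/
abbrev FinMSL : Type (u + 1) :=
  ObjectProperty.FullSubcategory fun M : SemilatInfCat.{u} => Finite M

/-- The forgetful functor `U : MSL_f ⥤ Set`. -/
def forgetFinMSL : FinMSL.{u} ⥤ Type u :=
  ObjectProperty.ι _ ⋙ forget SemilatInfCat.{u}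

open Classical in
/-- The finite power set monad `P_f` on `Set`. -/
def finPowerMonad : Monad (Type u) := ofTypeMonad Finset.{u}

/-- The full subcategory `Kl_f(P_f)` of the Kleisli category of `P_f` on the finite sets. -/
abbrev FinKleisli : Type (u + 1) :=
  ObjectProperty.FullSubcategory fun X : Kleisli finPowerMonad.{u} => Finite X.of

/-- The forgetful functor `U_{P_f} : Kl_f(P_f) ⥤ Set`, sending `X` to `P_f X` and a Kleisli
morphism `f : X → P_f Y` to its extension `P_f X → P_f Y`. -/
def forgetFinKleisli : FinKleisli.{u} ⥤ Type u :=
  ObjectProperty.ι _ ⋙ Kleisli.Adjunction.fromKleisli finPowerMonad.{u}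

end Functors

end CodensityFilter

end

/-!
A homomorphism from a finite meet-semilattice `M` to `2` is the indicator of a principal up-set.
Applied first to the semilattice of such homomorphisms and then to `M`, this makes `M` reflexive:
for every filter `φ` on `M` there is a unique point `φ.liminf` with `χ φ.liminf = φ χ` for all
`χ : M → 2`. These points make every finite meet-semilattice an algebra for the filter monad.

Let `G` be a full functor into finite meet-semilattices such that a cube `2 ^ ι` with at least two
coordinates is a retract of a value of `G`. A compatible family of elements `θ p`, for `p` ranging
over the maps from a set `X` to values of `G`, restricts along the retraction to a map
`φ : (X → 2) → 2`, and compatibility with the homomorphisms `2 ^ ι → 2` says that `φ` is a filter.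
Hence the filters on `X` are the limit defining the pointwise right Kan extension, and the codensity
monad is determined by its action on the functor. Both functors of the theorem are of this kind,
the second because finite subsets under reverse inclusion are the free meet-semilattices.
-/

noncomputable section

namespace CodensityFilter

open CategoryTheory CategoryTheory.Functor

section MonadAction

variable {A : Type w} [Category.{v} A] {C : Type w'} [Category.{v'} C]

/-- An action of the monad `T` on the functor `F`: the components of `α` make the values of `F`
algebras for `T`, so that `α` amounts to a lift of `F` to the Eilenberg–Moore category. -/
structure IsMonadAction {T : Monad C} {F : A ⥤ C} (α : F ⋙ T.toFunctor ⟶ F) : Prop where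
  unit (X : A) : T.η.app (F.obj X) ≫ α.app X = 𝟙 (F.obj X)
  mul (X : A) : T.μ.app (F.obj X) ≫ α.app X = T.map (α.app X) ≫ α.app X

theorem isMonadAction_codensityMonad (F : A ⥤ C) [F.HasRightKanExtension F] :
    IsMonadAction (T := codensityMonad F) (F.rightKanExtensionCounit F) where
  unit := codensityUnit_fac F
  mul := codensityMul_fac F

namespace IsMonadAction

variable {S T : Monad C} {F : A ⥤ C} {α : F ⋙ S.toFunctor ⟶ F} {β : F ⋙ T.toFunctor ⟶ F}

theorem unit_comp_lift [T.toFunctor.IsRightKanExtension β] (hα : IsMonadAction α)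
    (hβ : IsMonadAction β) :
    S.η ≫ T.toFunctor.liftOfIsRightKanExtension β S.toFunctor α = T.η := by
  apply T.toFunctor.hom_ext_of_isRightKanExtension β
  ext Y
  simp [hα.unit, hβ.unit]

theorem mul_comp_lift [T.toFunctor.IsRightKanExtension β] (hα : IsMonadAction α)
    (hβ : IsMonadAction β) :
    S.μ ≫ T.toFunctor.liftOfIsRightKanExtension β S.toFunctor α =
      (whiskerRight (T.toFunctor.liftOfIsRightKanExtension β S.toFunctor α) S.toFunctor ≫
        whiskerLeft T.toFunctor (T.toFunctor.liftOfIsRightKanExtension β S.toFunctor α)) ≫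
          T.μ := by
  apply T.toFunctor.hom_ext_of_isRightKanExtension β
  ext Y
  set lift := T.toFunctor.liftOfIsRightKanExtension β S.toFunctor α
  have lift_fac : lift.app (F.obj Y) ≫ β.app Y = α.app Y :=
    T.toFunctor.liftOfIsRightKanExtension_fac_app β S.toFunctor α Y
  calc
    _ = S.μ.app (F.obj Y) ≫ lift.app (F.obj Y) ≫ β.app Y := by simp
    _ = S.map (lift.app (F.obj Y) ≫ β.app Y) ≫ lift.app (F.obj Y) ≫ β.app Y := by
        rw [lift_fac, hα.mul]
    _ = S.map (lift.app (F.obj Y)) ≫ lift.app (T.obj (F.obj Y)) ≫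
          T.map (β.app Y) ≫ β.app Y := by
        rw [Functor.map_comp_assoc, lift.naturality_assoc]
    _ = S.map (lift.app (F.obj Y)) ≫ lift.app (T.obj (F.obj Y)) ≫
          T.μ.app (F.obj Y) ≫ β.app Y := by
        rw [hβ.mul]
    _ = _ := by simp

theorem whiskerLeft {B : Type*} [Category* B] (hα : IsMonadAction α) (G : B ⥤ A) :
    IsMonadAction (T := S) (F := G ⋙ F) (whiskerLeft G α) where
  unit X := hα.unit (G.obj X)
  mul X := hα.mul (G.obj X)

/-- Monads that act on `F` in such a way that their underlying functors are right Kan extensions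
of `F` along itself are isomorphic. -/
def isoOfIsRightKanExtension [S.toFunctor.IsRightKanExtension α]
    [T.toFunctor.IsRightKanExtension β] (hα : IsMonadAction α) (hβ : IsMonadAction β) : S ≅ T :=
  have hom_eq : (rightKanExtensionUnique S.toFunctor α T.toFunctor β).hom =
      T.toFunctor.liftOfIsRightKanExtension β S.toFunctor α := by simp
  MonadIso.mk (rightKanExtensionUnique S.toFunctor α T.toFunctor β)
    (NatTrans.congr_app (hom_eq ▸ unit_comp_lift hα hβ))
    (NatTrans.congr_app (hom_eq ▸ mul_comp_lift hα hβ))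

theorem isCodensityMonadOf (hα : IsMonadAction α)
    (hran : (RightExtension.mk S.toFunctor α).IsPointwiseRightKanExtension) :
    IsCodensityMonadOf S F := by
  have : F.HasPointwiseRightKanExtension F := hran.hasPointwiseRightKanExtension
  have : S.toFunctor.IsRightKanExtension α := hran.isRightKanExtension
  have : (codensityMonad F).toFunctor.IsRightKanExtension (F.rightKanExtensionCounit F) :=
    inferInstanceAs ((F.rightKanExtension F).IsRightKanExtension _)
  exact ⟨‹_›, ⟨hα.isoOfIsRightKanExtension (isMonadAction_codensityMonad F)⟩⟩

end IsMonadAction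

end MonadAction

section FiniteSemilattice

variable {M N : Type*} [SemilatticeInf M] [OrderTop M] [SemilatticeInf N] [OrderTop N]

open Classical in
/-- The indicator of the principal up-set of `m`, as a homomorphism to `2`. -/
def upperIndicator (m : M) : InfTopHom M Bool where
  toFun x := decide (m ≤ x)
  map_inf' _ _ := (Bool.decide_congr le_inf_iff).trans (Bool.decide_and _ _)
  map_top' := decide_eq_true le_top

theorem upperIndicator_eq_true_iff {m x : M} : upperIndicator m x = true ↔ m ≤ x :=
  open Classical in decide_eq_true_iff

theorem upperIndicator_le_iff {m : M} {χ : InfTopHom M Bool} :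
    upperIndicator m ≤ χ ↔ χ m = true := by
  refine ⟨fun h => h m (upperIndicator_eq_true_iff.2 le_rfl), fun hm x hx => ?_⟩
  exact OrderHomClass.mono χ (upperIndicator_eq_true_iff.1 hx) hm

theorem eq_of_forall_infTopHom {a b : M} (h : ∀ χ : InfTopHom M Bool, χ a = χ b) : a = b := by
  refine le_antisymm ?_ ?_ <;> rw [← upperIndicator_eq_true_iff]
  · rw [← h, upperIndicator_eq_true_iff]
  · rw [h, upperIndicator_eq_true_iff]

theorem exists_eq_upperIndicator [Finite M] (χ : InfTopHom M Bool) :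
    ∃ m, χ = upperIndicator m := by
  classical
  have := Fintype.ofFinite M
  let m : M := (Finset.univ.filter fun x => χ x = true).inf id
  have hm : χ m = true := by
    rw [map_finset_inf]
    exact (Finset.inf_eq_top_iff _ _).2 fun x hx => (Finset.mem_filter.1 hx).2
  refine ⟨m, le_antisymm (fun x hx => ?_) (upperIndicator_le_iff.2 hm)⟩
  exact upperIndicator_eq_true_iff.2 (Finset.inf_le (f := id) (by simpa using hx))

/-- The inclusion of homomorphisms into all maps, as a homomorphism for the pointwise structures. -/
def coeFnHom (M : Type*) [SemilatticeInf M] [OrderTop M] :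
    InfTopHom (InfTopHom M Bool) (M → Bool) where
  toFun χ := χ
  map_inf' _ _ := rfl
  map_top' := rfl

theorem exists_forall_apply_eq [Finite M] (Φ : InfTopHom (InfTopHom M Bool) Bool) :
    ∃ m : M, ∀ χ : InfTopHom M Bool, χ m = Φ χ := by
  have : Finite (InfTopHom M Bool) := DFunLike.finite _
  obtain ⟨χ₀, rfl⟩ := exists_eq_upperIndicator Φ
  obtain ⟨m, rfl⟩ := exists_eq_upperIndicator χ₀
  refine ⟨m, fun χ => Bool.eq_iff_iff.2 ?_⟩
  rw [upperIndicator_eq_true_iff, upperIndicator_le_iff]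

/-- Filters on `X`, encoded by their membership predicates as in the filter monad. -/
abbrev FilterOn (X : Type*) : Type _ := InfTopHom (X → Bool) Bool

/-- The image filter, whose members are the sets with preimage in `φ`. -/
def FilterOn.map {X Y : Type*} (p : X → Y) (φ : FilterOn X) : FilterOn Y where
  toFun s := φ (s ∘ p)
  map_inf' s t := map_inf φ (s ∘ p) (t ∘ p)
  map_top' := map_top φ

/-- The limit inferior of a filter on a finite meet-semilattice, which is the meet of its smallest
member. It is defined as the point with the property `FilterOn.apply_liminf`. -/
def FilterOn.liminf [Finite M] (φ : FilterOn M) : M :=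
  (exists_forall_apply_eq (φ.comp (coeFnHom M))).choose

theorem FilterOn.apply_liminf [Finite M] (φ : FilterOn M) (χ : InfTopHom M Bool) :
    χ φ.liminf = φ χ :=
  (exists_forall_apply_eq (φ.comp (coeFnHom M))).choose_spec χ

theorem FilterOn.liminf_eq_iff [Finite M] {φ : FilterOn M} {m : M} :
    φ.liminf = m ↔ ∀ χ : InfTopHom M Bool, χ m = φ χ := by
  refine ⟨fun h χ => h ▸ φ.apply_liminf χ, fun h => eq_of_forall_infTopHom fun χ => ?_⟩
  rw [φ.apply_liminf, h]

theorem FilterOn.liminf_map [Finite M] [Finite N] (g : InfTopHom M N) (φ : FilterOn M) :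
    (φ.map g).liminf = g φ.liminf :=
  liminf_eq_iff.2 fun χ => φ.apply_liminf (χ.comp g)

end FiniteSemilattice

section CompatibleFamily

/-- Evaluation at a coordinate, as a homomorphism from a cube to `2`. -/
def evalHom {ι : Type*} (i : ι) : InfTopHom (ι → Bool) Bool where
  toFun p := p i
  map_inf' _ _ := rfl
  map_top' := rfl

/-- The diagonal of a cube, as a homomorphism from `2`. -/
def diagHom (ι : Type*) : InfTopHom Bool (ι → Bool) where
  toFun := Function.const ι
  map_inf' _ _ := rfl
  map_top' := rfl

variable {κ : Type*} {M : κ → Type*} [∀ k, SemilatticeInf (M k)] [∀ k, OrderTop (M k)]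
  {ι : Type*} {k₀ : κ} {incl : InfTopHom (ι → Bool) (M k₀)} {retr : InfTopHom (M k₀) (ι → Bool)}
  {X : Type*} {θ : ∀ k, (X → M k) → M k}

theorem filterOn_ext_of_retract [Nonempty ι] (hretr : Function.LeftInverse retr incl)
    {φ ψ : FilterOn X}
    (h : ∀ (p : X → M k₀) (χ : InfTopHom (M k₀) Bool), φ (χ ∘ p) = ψ (χ ∘ p)) : φ = ψ := by
  obtain ⟨i⟩ := ‹Nonempty ι›
  refine InfTopHom.ext fun s => ?_
  have hs : ((evalHom i).comp retr) ∘ (incl ∘ diagHom ι ∘ s) = s :=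
    funext fun x => congrFun (hretr _) i
  simpa only [hs] using h (incl ∘ diagHom ι ∘ s) ((evalHom i).comp retr)

theorem exists_filterOn_of_compatible [Nontrivial ι] (hretr : Function.LeftInverse retr incl)
    (hθ : ∀ {k l : κ} (g : InfTopHom (M k) (M l)) (p : X → M k), g (θ k p) = θ l (g ∘ p)) :
    ∃ φ : FilterOn X, ∀ (k : κ) (p : X → M k) (χ : InfTopHom (M k) Bool),
      χ (θ k p) = φ (χ ∘ p) := by
  classical
  obtain ⟨i, j, hij⟩ := exists_pair_ne ι
  let coord (i : ι) : InfTopHom (M k₀) Bool := (evalHom i).comp retr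
  have coord_incl (i : ι) (q : ι → Bool) : coord i (incl q) = q i := congrFun (hretr q) i
  let φ (s : X → Bool) : Bool := coord i (θ k₀ (incl ∘ diagHom ι ∘ s))
  have apply_θ (k : κ) (p : X → M k) (χ : InfTopHom (M k) Bool) : χ (θ k p) = φ (χ ∘ p) := by
    have h := hθ ((incl.comp (diagHom ι)).comp χ) p
    exact (coord_incl i _).symm.trans (congrArg (coord i) h)
  have map_inf (s t : X → Bool) : φ (s ⊓ t) = φ s ⊓ φ t := by
    let pair (x : X) : M k₀ := incl (Function.update (Function.const ι (t x)) i (s x))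
    have hs : coord i ∘ pair = s := funext fun x => by simp [pair, coord_incl]
    have ht : coord j ∘ pair = t := funext fun x => by simp [pair, coord_incl, hij.symm]
    calc φ (s ⊓ t) = φ ((coord i ⊓ coord j : InfTopHom (M k₀) Bool) ∘ pair) := by
          rw [← hs, ← ht]; rfl
      _ = coord i (θ k₀ pair) ⊓ coord j (θ k₀ pair) := (apply_θ k₀ pair _).symm
      _ = φ s ⊓ φ t := by rw [apply_θ, apply_θ, hs, ht]
  have map_top : φ ⊤ = ⊤ := (apply_θ k₀ (fun _ => ⊤) ⊤).symm
  exact ⟨⟨⟨φ, map_inf⟩, map_top⟩, apply_θ⟩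

theorem existsUnique_filterOn_of_compatible [∀ k, Finite (M k)] [Nontrivial ι]
    (hretr : Function.LeftInverse retr incl)
    (hθ : ∀ {k l : κ} (g : InfTopHom (M k) (M l)) (p : X → M k), g (θ k p) = θ l (g ∘ p)) :
    ∃! φ : FilterOn X, ∀ (k : κ) (p : X → M k), (φ.map p).liminf = θ k p := by
  obtain ⟨φ, hφ⟩ := exists_filterOn_of_compatible hretr hθ
  refine ⟨φ, fun k p => FilterOn.liminf_eq_iff.2 (hφ k p), fun ψ hψ => ?_⟩
  refine filterOn_ext_of_retract hretr fun p χ => ?_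
  rw [← hφ, ← hψ, FilterOn.apply_liminf]
  rfl

end CompatibleFamily

section Criterion

instance (M : FinMSL.{u}) : Finite M.obj := M.property

/-- The action of the filter monad on finite meet-semilattices by limits inferior. -/
def liminfAction : forgetFinMSL.{u} ⋙ filterMonad.{u}.toFunctor ⟶ forgetFinMSL.{u} where
  app M := TypeCat.ofHom fun φ : FilterOn M.obj => φ.liminf
  naturality M N g := by
    ext φ
    exact FilterOn.liminf_map (M := M.obj) (N := N.obj) g.hom φ

theorem isMonadAction_liminfAction : IsMonadAction liminfAction.{u} where
  unit M := by
    ext m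
    exact FilterOn.liminf_eq_iff (M := M.obj).2 fun _ => rfl
  mul M := by
    ext Φ
    change FilterOn (FilterOn M.obj) at Φ
    refine FilterOn.liminf_eq_iff (M := M.obj).2 fun χ => ?_
    refine (FilterOn.apply_liminf (Φ.map FilterOn.liminf) χ).trans (congrArg Φ ?_)
    exact funext fun φ => φ.apply_liminf χ

/-- The finite meet-semilattice `2 ^ ι`. -/
def finCube (ι : Type u) [Finite ι] : FinMSL.{u} :=
  ⟨.of (ι → Bool), inferInstanceAs (Finite (ι → Bool))⟩

variable {A : Type w} [Category.{v} A]

theorem existsUnique_filterOn_of_section (G : A ⥤ FinMSL.{u}) [G.Full] {ι : Type u} [Finite ι]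
    [Nontrivial ι] {D : A} (cubeRetract : Retract (finCube ι) (G.obj D)) {X : Type u}
    {s : ∀ j : StructuredArrow X (G ⋙ forgetFinMSL), (G.obj j.right).obj}
    (hs : s ∈ (StructuredArrow.proj X (G ⋙ forgetFinMSL) ⋙ G ⋙ forgetFinMSL).sections) :
    ∃! φ : FilterOn X, ∀ j, (FilterOn.map (Y := (G.obj j.right).obj) j.hom φ).liminf = s j := by
  let arrow {Y : A} (p : X → (G.obj Y).obj) : StructuredArrow X (G ⋙ forgetFinMSL) :=
    StructuredArrow.mk (Y := Y) (TypeCat.ofHom p)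
  let θ (Y : A) (p : X → (G.obj Y).obj) : (G.obj Y).obj := s (arrow p)
  have hθ {Y Z : A} (g : InfTopHom (G.obj Y).obj (G.obj Z).obj) (p : X → (G.obj Y).obj) :
      g (θ Y p) = θ Z (g ∘ p) := by
    obtain ⟨f, hf⟩ := G.map_surjective (ObjectProperty.homMk g)
    have hcomp : (arrow p).hom ≫ (G ⋙ forgetFinMSL).map f = (arrow (g ∘ p)).hom := by
      ext x
      exact ConcreteCategory.congr_hom hf (p x)
    calc g (θ Y p) = (G.map f).hom (θ Y p) := (ConcreteCategory.congr_hom hf (θ Y p)).symm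
      _ = θ Z (g ∘ p) := hs (StructuredArrow.homMk f hcomp : arrow p ⟶ arrow (g ∘ p))
  have hretr : Function.LeftInverse
      (cubeRetract.r.hom : InfTopHom (G.obj D).obj (ι → Bool))
      (cubeRetract.i.hom : InfTopHom (ι → Bool) (G.obj D).obj) :=
    fun q => ConcreteCategory.congr_hom cubeRetract.retract q
  obtain ⟨φ, hφ, hunique⟩ :=
    existsUnique_filterOn_of_compatible (M := fun Y => (G.obj Y).obj) (θ := θ) hretr hθ
  exact ⟨φ, fun j => hφ j.right j.hom, fun ψ hψ => hunique ψ fun _ p => hψ (arrow p)⟩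

theorem isCodensityMonadOf_filterMonad_of_full (G : A ⥤ FinMSL.{u}) [G.Full] {ι : Type u}
    [Finite ι] [Nontrivial ι] {D : A} (cubeRetract : Retract (finCube ι) (G.obj D)) :
    IsCodensityMonadOf filterMonad.{u} (G ⋙ forgetFinMSL) := by
  refine (isMonadAction_liminfAction.whiskerLeft G).isCodensityMonadOf fun X => ?_
  refine Nonempty.some ((Limits.Types.isLimit_iff _).2 fun s hs => ?_)
  exact existsUnique_filterOn_of_section G cubeRetract hs

theorem isCodensityMonadOf_forgetFinMSL : IsCodensityMonadOf filterMonad.{u} forgetFinMSL.{u} :=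
  isCodensityMonadOf_filterMonad_of_full (𝟭 FinMSL) (Retract.refl (finCube (ULift Bool)))

end Criterion

section Kleisli

open OrderDual

variable {X L : Type*} [SemilatticeInf L] [OrderTop L]

open Classical in
/-- Finite subsets under reverse inclusion form the free meet-semilattice with top on `X`; this is
the homomorphism extending `f`. -/
def finsetLift (f : X → L) : InfTopHom (Finset X)ᵒᵈ L where
  toFun S := (ofDual S).inf f
  map_inf' _ _ := Finset.inf_union
  map_top' := Finset.inf_empty

open Classical in
theorem finsetLift_comp_singleton (g : InfTopHom (Finset X)ᵒᵈ L) :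
    finsetLift (fun x => g (toDual {x})) = g := by
  refine InfTopHom.ext fun S => ?_
  calc (ofDual S).inf (fun x => g (toDual {x}))
      = g ((ofDual S).inf fun x => toDual {x}) := (map_finset_inf g _ _).symm
    _ = g (toDual ((ofDual S).sup singleton)) := by rw [Finset.toDual_sup]; rfl
    _ = g S := by rw [Finset.sup_singleton_eq_self, toDual_ofDual]

/-- The relation underlying a morphism of finite sets in the Kleisli category. -/
def kleisliRelation {X Y : FinKleisli.{u}} (f : X ⟶ Y) (x : X.obj.of) : (Finset Y.obj.of)ᵒᵈ :=
  toDual (f.hom.of x)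

open Classical in
theorem forgetFinKleisli_map_eq_finsetLift {X Y : FinKleisli.{u}} (f : X ⟶ Y)
    (S : (Finset X.obj.of)ᵒᵈ) :
    forgetFinKleisli.map f (ofDual S) = ofDual (finsetLift (kleisliRelation f) S) :=
  -- `finPowerMonad` compares finite sets by `Classical.propDecidable`, not by `Finset.decidableEq`.
  @Finset.sup_image _ _ _ _ _ (fun _ _ => Classical.propDecidable _) (ofDual S)
    (ofDual ∘ kleisliRelation f) id

open Classical in
/-- The lift of `forgetFinKleisli` to meet-semilattices, obtained by ordering finite subsets by
reverse inclusion. -/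
def finKleisliToFinMSL : FinKleisli.{u} ⥤ FinMSL.{u} where
  obj X := ⟨.of (Finset X.obj.of)ᵒᵈ,
    have : Finite X.obj.of := X.property
    inferInstanceAs (Finite (Finset X.obj.of))⟩
  map {X Y} f := ObjectProperty.homMk
    (show InfTopHom (Finset X.obj.of)ᵒᵈ (Finset Y.obj.of)ᵒᵈ from
      (finsetLift (kleisliRelation f)).copy (fun S => toDual (forgetFinKleisli.map f (ofDual S)))
        (funext fun S => forgetFinKleisli_map_eq_finsetLift f S))
  map_id X := ObjectProperty.hom_ext _
    (InfTopHom.ext fun S => ConcreteCategory.congr_hom (forgetFinKleisli.map_id X) S)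
  map_comp f g := ObjectProperty.hom_ext _
    (InfTopHom.ext fun S => ConcreteCategory.congr_hom (forgetFinKleisli.map_comp f g) S)

theorem finKleisliToFinMSL_comp_forgetFinMSL :
    finKleisliToFinMSL.{u} ⋙ forgetFinMSL = forgetFinKleisli :=
  rfl

instance : finKleisliToFinMSL.{u}.Full where
  map_surjective {X Y} g := by
    classical
    let h : InfTopHom (Finset X.obj.of)ᵒᵈ (Finset Y.obj.of)ᵒᵈ := g.hom
    let f : X ⟶ Y := ObjectProperty.homMk ⟨TypeCat.ofHom fun x => ofDual (h (toDual {x}))⟩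
    refine ⟨f, ObjectProperty.hom_ext _ (InfTopHom.ext fun S => ?_)⟩
    exact (forgetFinKleisli_map_eq_finsetLift f S).trans
      (DFunLike.congr_fun (finsetLift_comp_singleton h) S)

open Classical in
/-- The complement of the set with a given indicator function, as a homomorphism for reverse
inclusion. -/
def zeroSetHom (ι : Type*) [Fintype ι] : InfTopHom (ι → Bool) (Finset ι)ᵒᵈ where
  toFun p := toDual (Finset.univ.filter fun i => p i = false)
  map_inf' p q := by
    rw [← toDual_sup, Finset.sup_eq_union, ← Finset.filter_or]
    exact congrArg toDual (Finset.filter_congr fun i _ => Bool.and_eq_false_iff)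
  map_top' := by simp

open Classical in
/-- The indicator function of the complement of a finite set, as a homomorphism for reverse
inclusion. -/
def complIndicatorHom (ι : Type*) : InfTopHom (Finset ι)ᵒᵈ (ι → Bool) where
  toFun S i := decide (i ∉ ofDual S)
  map_inf' S T := by
    ext i
    simp
  map_top' := by
    ext i
    simp

theorem complIndicatorHom_zeroSetHom {ι : Type*} [Fintype ι] (p : ι → Bool) :
    complIndicatorHom ι (zeroSetHom ι p) = p := by
  ext i
  simp [complIndicatorHom, zeroSetHom]

/-- The cube `2 ^ ι` as a retract of the finite subsets of `ι`. -/
def finCubeRetract (ι : Type u) [Fintype ι] :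
    Retract (finCube ι) (finKleisliToFinMSL.obj ⟨.mk _ ι, inferInstanceAs (Finite ι)⟩) where
  i := ObjectProperty.homMk (zeroSetHom ι)
  r := ObjectProperty.homMk (complIndicatorHom ι)
  retract := ObjectProperty.hom_ext _ (InfTopHom.ext complIndicatorHom_zeroSetHom)

theorem isCodensityMonadOf_forgetFinKleisli :
    IsCodensityMonadOf filterMonad.{u} forgetFinKleisli.{u} :=
  finKleisliToFinMSL_comp_forgetFinMSL ▸
    isCodensityMonadOf_filterMonad_of_full finKleisliToFinMSL (finCubeRetract (ULift Bool))

end Kleisli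

end CodensityFilter

end

theorem mainTheorem3 :
    CodensityFilter.IsCodensityMonadOf CodensityFilter.filterMonad.{u}
        CodensityFilter.forgetFinMSL.{u} ∧
      CodensityFilter.IsCodensityMonadOf CodensityFilter.filterMonad.{u}
        CodensityFilter.forgetFinKleisli.{u} := by
  exact ⟨CodensityFilter.isCodensityMonadOf_forgetFinMSL,
    CodensityFilter.isCodensityMonadOf_forgetFinKleisli⟩
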